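/- **Theorem 3.2.** Let $D([0,1],\mathbb R^d)$ be the space of càdlàg functions $[0,1]\to\mathbb R^d$. For $x\in D([0,1],\mathbb R)$ put $x(0-)=x(0)$ and let $\Gamma_x=\{(t,z)\in[0,1]\times\mathbb R : z\in[x(t-),x(t)]\}$ be its completed graph, where $[a,b]$ denotes the segment between $a$ and $b$ also if $a>b$. Order it by $(t_1,z_1)\le(t_2,z_2)$ if $t_1<t_2$, or $t_1=t_2$ and $|x(t_1-)-z_1|\le|x(t_2-)-z_2|$. Let $\Pi(x)$ be the set of continuous nondecreasing maps $(r,u)$ of $[0,1]$ onto $\Gamma_x$, with time component $r$ and spatial component $u$. The $M_1$ topology on $D([0,1],\mathbb R)$ is the topology of the metric $$d_{M_1}(x_1,x_2)=\inf\{\|r_1-r_2\|_\infty\vee\|u_1-u_2\|_\infty : (r_i,u_i)\in\Pi(x_i),\ i=1,2\}.$$ The weak $M_1$ topology on $D([0,1],\mathbb R^2)$ is the product topology obtained from the $M_1$ topology on each of the two components. Random elements are measurable with respect to the Borel $\sigma$-field of these topologies. For a random element $Y$ of $D([0,1],\mathbb R)$ let $T_Y=\{t\in(0,1] : \Pr(t\in\mathrm{Disc}(Y))=0\}\cup\{1\}$,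 where $\mathrm{Disc}(x)$ is the set of discontinuity points of $x$. Let $(Y_n,Q_n)$, $n\in\mathbb N$, and $(Y,Q)$ be random elements of $D([0,1],\mathbb R^2)$, each defined on its own probability space. Suppose that 1. the sequences $(Y_n)$ and $(Q_n)$ are each tight with respect to the $M_1$ topology, and 2. for all $k\in\mathbb N$ and all $t_1,\dots,t_k\in T_Y\cap T_Q$, as $n\to\infty$, $$(Y_n(t_1),\dots,Y_n(t_k),Q_n(t_1),\dots,Q_n(t_k))\to(Y(t_1),\dots,Y(t_k),Q(t_1),\dots,Q(t_k))$$ in distribution in $\mathbb R^{2k}$. Then $(Y_n,Q_n)$ converges in distribution to $(Y,Q)$ in $D([0,1],\mathbb R^2)$ with the weak $M_1$ topology. -/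

import Mathlib

open Set Filter Topology MeasureTheory
open scoped unitInterval ENNReal

/-- `SkorokhodD E` is the space `D([0,1], E)` of càdlàg functions `[0,1] → E`: functions that are
right-continuous and have left limits (both conditions are relative to `[0,1]`, so the left limit
at `0` and the right-continuity at `1` are void). -/
structure SkorokhodD (E : Type*) [TopologicalSpace E] where
  /-- the underlying function -/
  toFun : I → E
  right_continuous' : ∀ t, ContinuousWithinAt toFun (Ici t) t
  exists_left_limit' : ∀ t, ∃ l, Tendsto toFun (𝓝[<] t) (𝓝 l)

namespace SkorokhodD

instance {E : Type*} [TopologicalSpace E] : CoeFun (SkorokhodD E) (fun _ => I → E) :=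
  ⟨SkorokhodD.toFun⟩

/-- `Disc(x)`, the set of discontinuity points of `x`. -/
def disc {E : Type*} [TopologicalSpace E] (x : SkorokhodD E) : Set I :=
  {t | ¬ ContinuousAt x t}

/-- The first component of an element of `D([0,1], ℝ²)`. -/
def fst (z : SkorokhodD (ℝ × ℝ)) : SkorokhodD ℝ where
  toFun t := (z t).1
  right_continuous' t := (z.right_continuous' t).fst
  exists_left_limit' t := by
    obtain ⟨l, hl⟩ := z.exists_left_limit' t
    exact ⟨l.1, (continuous_fst.tendsto l).comp hl⟩

/-- The second component of an element of `D([0,1], ℝ²)`. -/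
def snd (z : SkorokhodD (ℝ × ℝ)) : SkorokhodD ℝ where
  toFun t := (z t).2
  right_continuous' t := (z.right_continuous' t).snd
  exists_left_limit' t := by
    obtain ⟨l, hl⟩ := z.exists_left_limit' t
    exact ⟨l.2, (continuous_snd.tendsto l).comp hl⟩

/-- The left limit `x(t-)`, with the usual convention `x(0-) = x(0)`
(this is the value of `Function.leftLim` at a bottom element). -/
noncomputable def leftLimit (x : SkorokhodD ℝ) (t : I) : ℝ :=
  Function.leftLim x t

/-- The completed graph `Γ_x = {(t, z) ∈ [0,1] × ℝ : z ∈ [x(t-), x(t)]}`, where `[a, b]` is the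
segment joining `a` and `b`, in whichever order they come. -/
def completedGraph (x : SkorokhodD ℝ) : Set (I × ℝ) :=
  {p | p.2 ∈ uIcc (x.leftLimit p.1) (x p.1)}

/-- The order on the completed graph: `(t₁, z₁) ≤ (t₂, z₂)` if `t₁ < t₂`, or `t₁ = t₂` and
`|x(t₁-) - z₁| ≤ |x(t₂-) - z₂|`. -/
def GraphLE (x : SkorokhodD ℝ) (p q : I × ℝ) : Prop :=
  p.1 < q.1 ∨ (p.1 = q.1 ∧ |x.leftLimit p.1 - p.2| ≤ |x.leftLimit q.1 - q.2|)

/-- `(r, u) ∈ Π(x)`: the pair of continuous functions `r : [0,1] → [0,1]`, `u : [0,1] → ℝ` is a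
parametric representation of `Γ_x`, i.e. it is nondecreasing for the order of the graph and maps
`[0,1]` onto `Γ_x`. -/
structure IsParamRep (x : SkorokhodD ℝ) (r : C(I, I)) (u : C(I, ℝ)) : Prop where
  range_eq : range (fun s => (r s, u s)) = x.completedGraph
  mono : ∀ s s', s ≤ s' → x.GraphLE (r s, u s) (r s', u s')

/-- The `M₁` distance `d_{M₁}(x, y)`: the infimum of `‖r₁ - r₂‖ ∨ ‖u₁ - u₂‖` (supremum norms) over
`(r₁, u₁) ∈ Π(x)` and `(r₂, u₂) ∈ Π(y)`. It is written with values in `[0, ∞]`. The extended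
distance on the spaces `C(I, I)` and `C(I, ℝ)` is the uniform one. -/
noncomputable def distM1 (x y : SkorokhodD ℝ) : ℝ≥0∞ :=
  ⨅ (r₁ : C(I, I)) (u₁ : C(I, ℝ)) (_ : x.IsParamRep r₁ u₁)
    (r₂ : C(I, I)) (u₂ : C(I, ℝ)) (_ : y.IsParamRep r₂ u₂),
    max (edist r₁ r₂) (edist u₁ u₂)

/-- The Skorokhod `M₁` topology on `D([0,1], ℝ)`, i.e. the topology of the metric `d_{M₁}`: a set
is open if with each of its points `x` it contains a ball `{y | d_{M₁}(x, y) < ε}`, `ε > 0`. -/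
instance topologyM1 : TopologicalSpace (SkorokhodD ℝ) where
  IsOpen U := ∀ x ∈ U, ∃ ε : ℝ≥0∞, 0 < ε ∧ ∀ y, distM1 x y < ε → y ∈ U
  isOpen_univ := fun _ _ => ⟨1, one_pos, fun _ _ => mem_univ _⟩
  isOpen_inter := by
    rintro U V hU hV x ⟨hxU, hxV⟩
    obtain ⟨a, ha, hUa⟩ := hU x hxU
    obtain ⟨b, hb, hVb⟩ := hV x hxV
    exact ⟨min a b, lt_min ha hb, fun y hy =>
      ⟨hUa y (hy.trans_le (min_le_left _ _)), hVb y (hy.trans_le (min_le_right _ _))⟩⟩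
  isOpen_sUnion := by
    rintro S hS x ⟨U, hU, hxU⟩
    obtain ⟨a, ha, hUa⟩ := hS U hU x hxU
    exact ⟨a, ha, fun y hy => ⟨U, hU, hUa y hy⟩⟩

/-- The weak `M₁` topology on `D([0,1], ℝ²)`: the product topology, i.e. the topology carried over
from `D([0,1], ℝ) × D([0,1], ℝ)` with the `M₁` topology on both factors. -/
instance topologyWeakM1 : TopologicalSpace (SkorokhodD (ℝ × ℝ)) :=
  TopologicalSpace.induced (fun z => (z.fst, z.snd)) inferInstance

/-- The Borel `σ`-algebra of the `M₁` topology. -/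
instance : MeasurableSpace (SkorokhodD ℝ) := borel _

instance : BorelSpace (SkorokhodD ℝ) := ⟨rfl⟩

/-- The Borel `σ`-algebra of the weak `M₁` topology. -/
instance : MeasurableSpace (SkorokhodD (ℝ × ℝ)) := borel _

instance : BorelSpace (SkorokhodD (ℝ × ℝ)) := ⟨rfl⟩

/-- `T_Y = {t ∈ (0,1] : Pr(t ∈ Disc(Y)) = 0} ∪ {1}` for a process `Y` with paths in
`D([0,1], ℝ)`. -/
def continuityTimes {Ω : Type*} [MeasurableSpace Ω] (P : Measure Ω) (Y : Ω → SkorokhodD ℝ) :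
    Set I :=
  {t | 0 < t ∧ P {ω | t ∈ (Y ω).disc} = 0} ∪ {1}

end SkorokhodD

/-! Evaluation at a fixed time is not `M₁`-continuous, but an average over a short window of times
is: `M₁`-convergence forces pointwise convergence at the continuity points of the limit and at time
1, and a càdlàg path has only countably many discontinuities, so dominated convergence applies
(`continuous_windowMean`). Averaging `arctan` of the path keeps these functionals bounded. As the
window shrinks to its left end, right-continuity returns the value of the path, so the window means
of both components at a countable dense set of times containing 1 inject the path space continuously
into a compact cube (`injective_windowMeans`).

Two facts then give the theorem. For a tight sequence, weak convergence of the images under a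
continuous injection into a compact Hausdorff space implies weak convergence upstairs
(`tendsto_of_isTightMeasureSet_of_injective`); this needs neither Prokhorov's theorem nor
completeness of the metric. In the cube, by Stone–Weierstrass, it suffices that mixed moments of the
coordinates converge. By Fubini such a moment is an integral, over tuples of times, of expectations
of products of `arctan` of values at fixed times. Almost every tuple lies in `T_Y ∩ T_Q`, so the
finite-dimensional hypothesis and dominated convergence finish (`tendsto_integral_prod_windowMean`).
-/

namespace SkorokhodD

/-! ### Paths -/

@[ext]
theorem ext_fun {E : Type*} [TopologicalSpace E] {x y : SkorokhodD E} (h : ∀ t, x t = y t) :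
    x = y := by
  cases x; cases y; congr; exact funext h

theorem leftLimit_mem {x : SkorokhodD ℝ} {r : I} {s : Set ℝ} (hs : IsClosed s)
    (h : ∀ᶠ q in 𝓝 r, x q ∈ s) : x.leftLimit r ∈ s := by
  unfold leftLimit
  by_cases hb : 𝓝[<] r = ⊥
  · rw [leftLim_eq_of_eq_bot _ hb]
    exact h.self_of_nhds
  · have : NeBot (𝓝[<] r) := ⟨hb⟩
    obtain ⟨l, hl⟩ := x.exists_left_limit' r
    rw [leftLim_eq_of_tendsto hl]
    exact hs.mem_of_tendsto hl (h.filter_mono nhdsWithin_le_nhds)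

theorem mem_of_mem_completedGraph {x : SkorokhodD ℝ} {r : I} {z : ℝ} {s : Set ℝ}
    (hs : IsClosed s) (hc : s.OrdConnected) (h : ∀ᶠ q in 𝓝 r, x q ∈ s)
    (hz : (r, z) ∈ x.completedGraph) : z ∈ s :=
  hc.uIcc_subset (leftLimit_mem hs h) h.self_of_nhds hz

theorem mem_completedGraph (x : SkorokhodD ℝ) (t : I) : (t, x t) ∈ x.completedGraph :=
  right_mem_uIcc

theorem continuousAt_of_tendsto_left {x : SkorokhodD ℝ} {t : I}
    (h : Tendsto x (𝓝[<] t) (𝓝 (x t))) : ContinuousAt x t :=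
  continuousAt_iff_continuous_left_right.2 ⟨continuousWithinAt_Iio_iff_Iic.1 h, x.right_continuous' t⟩

/-- `D n` collects the points where the oscillation exceeds `1 / (n + 1)`. Near any `t` the
one-sided limits make the oscillation small on each side of `t`, so `D n` has no accumulation point
and is finite by compactness. -/
theorem countable_disc (x : SkorokhodD ℝ) : x.disc.Countable := by
  let D : ℕ → Set I := fun n => {t | ∀ U ∈ 𝓝 t, ∃ a ∈ U, ∃ b ∈ U, 1 / ((n : ℝ) + 1) < dist (x a) (x b)}
  have hfin : ∀ n, (D n).Finite := by
    intro n
    by_contra hinf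
    obtain ⟨t, -, ht⟩ := Set.Infinite.exists_accPt_of_subset_isCompact hinf isCompact_univ
      (subset_univ _)
    rw [accPt_iff_frequently_nhdsNE] at ht
    refine ht ?_
    have hpos : (0 : ℝ) < 1 / ((n : ℝ) + 1) / 2 := by positivity
    have key : ∀ (l : ℝ) (U : Set I), IsOpen U → (∀ s ∈ U, dist (x s) l < 1 / ((n : ℝ) + 1) / 2) →
        ∀ s ∈ U, s ∉ D n := by
      intro l U hU h s hs hsD
      obtain ⟨a, ha, b, hb, hab⟩ := hsD U (hU.mem_nhds hs)
      have := dist_triangle_right (x a) (x b) l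
      linarith [h a ha, h b hb]
    have key2 : ∀ (l : ℝ) (s : Set I), IsOpen s → Tendsto x (𝓝[s] t) (𝓝 l) →
        ∀ᶠ q in 𝓝[s] t, q ∉ D n := by
      intro l s hso hl
      have := hl (Metric.ball_mem_nhds l hpos)
      obtain ⟨V, hV, htV, hVs⟩ := mem_nhdsWithin.1 this
      filter_upwards [mem_nhdsWithin.2 ⟨V, hV, htV, subset_rfl⟩] with q hq
      exact key l (V ∩ s) (hV.inter hso) (fun q hq => hVs hq) q hq
    obtain ⟨l, hl⟩ := x.exists_left_limit' t
    rw [← nhdsLT_sup_nhdsGT, eventually_sup]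
    exact ⟨key2 l _ isOpen_Iio hl, key2 (x t) _ isOpen_Ioi
      ((x.right_continuous' t).mono Ioi_subset_Ici_self)⟩
  refine (countable_iUnion fun n => (hfin n).countable).mono ?_
  intro t ht
  by_contra hcon
  refine ht ?_
  rw [Metric.continuousAt_iff']
  intro ε hε
  obtain ⟨n, hn⟩ := exists_nat_one_div_lt hε
  have : t ∉ D n := fun h => hcon (mem_iUnion.2 ⟨n, h⟩)
  simp only [D, mem_ofPred_eq, not_forall] at this
  obtain ⟨U, hU, h⟩ := this
  push Not at h
  filter_upwards [hU] with s hs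
  exact (h s hs t (mem_of_mem_nhds hU)).trans_lt hn

/-- The point `t - 1 / (n + 1)`, cut off at `0`. -/
noncomputable def shiftLeft (n : ℕ) (t : I) : I := projIcc 0 1 zero_le_one ((t : ℝ) - 1 / ((n : ℝ) + 1))

theorem measurable_shiftLeft (n : ℕ) : Measurable (shiftLeft n) := by
  unfold shiftLeft
  exact (continuous_projIcc.comp (by fun_prop)).measurable

theorem tendsto_shiftLeft (t : I) : Tendsto (fun n => shiftLeft n t) atTop (𝓝 t) := by
  have h : Tendsto (fun n : ℕ => (t : ℝ) - 1 / ((n : ℝ) + 1)) atTop (𝓝 t) := by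
    simpa using tendsto_const_nhds.sub (tendsto_one_div_add_atTop_nhds_zero_nat (𝕜 := ℝ))
  have := (continuous_projIcc (h := zero_le_one (α := ℝ))).continuousAt.tendsto.comp h
  simpa [shiftLeft, Function.comp_def] using this

theorem shiftLeft_lt (n : ℕ) {t : I} (ht : 0 < t) : shiftLeft n t < t := by
  rw [← Subtype.coe_lt_coe, shiftLeft, coe_projIcc]
  have h0 : (0 : ℝ) < t := ht
  have h1 : (0 : ℝ) < 1 / ((n : ℝ) + 1) := by positivity
  refine max_lt h0 ((min_le_right _ _).trans_lt ?_)
  linarith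

/-- The left limit exists, so one sequence from the left detects it. Testing continuity along a
sequence is what makes the discontinuity set measurable. -/
theorem continuousAt_iff_tendsto_shiftLeft (x : SkorokhodD ℝ) (t : I) :
    ContinuousAt x t ↔ Tendsto (fun n => x (shiftLeft n t)) atTop (𝓝 (x t)) := by
  refine ⟨fun h => h.tendsto.comp (tendsto_shiftLeft t), fun h => ?_⟩
  apply continuousAt_of_tendsto_left
  rcases eq_or_lt_of_le (unitInterval.nonneg' : 0 ≤ t) with rfl | ht
  · have : Iio (0 : I) = ∅ := by
      ext s; simp
    simp [this]
  · obtain ⟨l, hl⟩ := x.exists_left_limit' t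
    have := hl.comp (tendsto_nhdsWithin_iff.2 ⟨tendsto_shiftLeft t,
      Eventually.of_forall fun n => shiftLeft_lt n ht⟩)
    rwa [tendsto_nhds_unique h this]

/-- The point `m / (k + 1)`, cut off at `1`. -/
noncomputable def gridPoint (k m : ℕ) : I := projIcc 0 1 zero_le_one ((m : ℝ) / ((k : ℝ) + 1))

theorem tendsto_gridPoint (t : I) :
    Tendsto (fun k : ℕ => gridPoint k (⌊((k : ℝ) + 1) * t⌋₊ + 1)) atTop (𝓝[≥] t) := by
  -- The `+ 1` after the floor puts the grid point to the right of `t`, where right-continuity can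
  -- be used.
  have h0 : (0 : ℝ) ≤ t := t.2.1
  have hle : ∀ k : ℕ, (t : ℝ) ≤ ((⌊((k : ℝ) + 1) * t⌋₊ + 1 : ℕ) : ℝ) / ((k : ℝ) + 1) := by
    intro k
    rw [le_div_iff₀ (by positivity), mul_comm]
    push_cast
    exact (Nat.lt_floor_add_one _).le
  have hge : ∀ k : ℕ, ((⌊((k : ℝ) + 1) * t⌋₊ + 1 : ℕ) : ℝ) / ((k : ℝ) + 1) ≤
      t + 1 / ((k : ℝ) + 1) := by
    intro k
    have hk : (0 : ℝ) < (k : ℝ) + 1 := by positivity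
    have h1 := Nat.floor_le (mul_nonneg hk.le h0)
    rw [div_le_iff₀ hk, add_mul _ _ ((k : ℝ) + 1), one_div_mul_cancel hk.ne']
    push_cast
    linarith
  refine tendsto_nhdsWithin_iff.2 ⟨?_, Eventually.of_forall fun k => ?_⟩
  · have h : Tendsto (fun k : ℕ => ((⌊((k : ℝ) + 1) * t⌋₊ + 1 : ℕ) : ℝ) / ((k : ℝ) + 1)) atTop
        (𝓝 t) := by
      refine tendsto_of_tendsto_of_tendsto_of_le_of_le tendsto_const_nhds ?_ hle hge
      simpa using tendsto_const_nhds.add (tendsto_one_div_add_atTop_nhds_zero_nat (𝕜 := ℝ))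
    have := (continuous_projIcc (h := zero_le_one (α := ℝ))).continuousAt.tendsto.comp h
    simpa [gridPoint, Function.comp_def] using this
  · have := monotone_projIcc (zero_le_one (α := ℝ)) (hle k)
    rwa [projIcc_val] at this

/-- By right-continuity the process is a pointwise limit of processes that are constant in time on
each grid cell, and these involve only countably many times. -/
theorem measurable_uncurry {Ω : Type*} [MeasurableSpace Ω] {Y : Ω → SkorokhodD ℝ}
    (hY : ∀ t, Measurable fun ω => Y ω t) : Measurable fun p : Ω × I => Y p.1 p.2 := by
  refine measurable_of_tendsto_metrizable
    (f := fun (k : ℕ) (p : Ω × I) => Y p.1 (gridPoint k (⌊((k : ℝ) + 1) * p.2⌋₊ + 1))) ?_ ?_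
  · intro k
    have h1 : Measurable fun q : Ω × ℕ => Y q.1 (gridPoint k (q.2 + 1)) :=
      measurable_from_prod_countable_left fun m => hY (gridPoint k (m + 1))
    have h2 : Measurable fun p : Ω × I => (p.1, ⌊((k : ℝ) + 1) * p.2⌋₊) := by
      refine measurable_fst.prodMk (Nat.measurable_floor.comp ?_)
      exact measurable_const.mul (measurable_subtype_coe.comp measurable_snd)
    exact h1.comp h2
  · rw [tendsto_pi_nhds]
    rintro ⟨ω, t⟩
    exact ((Y ω).right_continuous' t).tendsto.comp (tendsto_gridPoint t)

theorem measurable_path (x : SkorokhodD ℝ) : Measurable x :=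
  (measurable_uncurry (Y := fun _ : Unit => x) fun _ => measurable_const).comp
    (measurable_const.prodMk measurable_id : Measurable fun t : I => ((), t))

theorem measurableSet_mem_disc {Ω : Type*} [MeasurableSpace Ω] {Y : Ω → SkorokhodD ℝ}
    (hY : ∀ t, Measurable fun ω => Y ω t) : MeasurableSet {p : Ω × I | p.2 ∈ (Y p.1).disc} := by
  have h := measurable_uncurry hY
  have h1 := measurableSet_tendsto_fun (l := atTop)
    (f := fun (n : ℕ) (p : Ω × I) => Y p.1 (shiftLeft n p.2))
    (fun n => h.comp (measurable_fst.prodMk ((measurable_shiftLeft n).comp measurable_snd))) h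
  convert h1.compl using 1
  ext p
  simp only [disc, mem_ofPred_eq, mem_compl_iff, continuousAt_iff_tendsto_shiftLeft]

end SkorokhodD

/-! ### Weak convergence through a continuous injection into a compact space -/

section WeakConvergence

open scoped BoundedContinuousFunction

theorem dist_integral_le_of_eqOn {E : Type*} [TopologicalSpace E] [MeasurableSpace E]
    [OpensMeasurableSpace E] (μ : Measure E) [IsProbabilityMeasure μ] {f g : E →ᵇ ℝ} {K : Set E}
    (h : EqOn f g K) :
    dist (∫ x, f x ∂μ) (∫ x, g x ∂μ) ≤ (‖f‖ + ‖g‖) * μ.real Kᶜ := by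
  rw [dist_eq_norm, ← integral_sub (f.integrable μ) (g.integrable μ),
    ← setIntegral_eq_integral_of_forall_compl_eq_zero (s := Kᶜ)]
  · refine norm_setIntegral_le_of_norm_le_const (measure_lt_top _ _) fun x _ => ?_
    exact (norm_sub_le _ _).trans (add_le_add (f.norm_coe_le_norm x) (g.norm_coe_le_norm x))
  · intro x hx
    rw [h (notMem_compl_iff.1 hx), sub_self]

/-- On a compact `K` carrying almost all the mass, `Φ` is a closed embedding, so `f` restricted to
`K` extends by Tietze to a function `g` on `C` of the same norm. Convergence is known for `g ∘ Φ`,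
which differs from `f` only off `K`. -/
theorem MeasureTheory.ProbabilityMeasure.tendsto_of_isTightMeasureSet_of_injective {E C : Type*}
    [TopologicalSpace E] [MeasurableSpace E] [BorelSpace E] [TopologicalSpace C] [T2Space C]
    [NormalSpace C] [MeasurableSpace C] [BorelSpace C] [HasOuterApproxClosed C]
    {μ : ℕ → ProbabilityMeasure E} {ν : ProbabilityMeasure E} {Φ : E → C} (hΦ : Continuous Φ)
    (hinj : Function.Injective Φ) (ht : IsTightMeasureSet (range fun n => (μ n : Measure E)))
    (h : Tendsto (fun n => (μ n).map hΦ.measurable.aemeasurable) atTop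
      (𝓝 (ν.map hΦ.measurable.aemeasurable))) :
    Tendsto μ atTop (𝓝 ν) := by
  have : T2Space E := T2Space.of_injective_continuous hinj hΦ
  rw [ProbabilityMeasure.tendsto_iff_forall_integral_tendsto]
  intro f
  rw [Metric.tendsto_atTop]
  intro ε hε
  -- Replacing `f` by `g ∘ Φ` will cost at most `2‖f‖δ`, once under `μ n` and once under `ν`; with
  -- `ε / 4` for the convergence of `g` the total is below `ε`. The `+ 1` covers `f = 0`.
  obtain ⟨δ, hδ, hfδ⟩ : ∃ δ : ℝ, 0 < δ ∧ (‖f‖ + ‖f‖) * δ ≤ ε / 4 := by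
    refine ⟨ε / (8 * (‖f‖ + 1)), by positivity, ?_⟩
    have := norm_nonneg f
    rw [← two_mul, mul_div_assoc', div_le_div_iff₀ (by positivity) (by positivity)]
    nlinarith
  obtain ⟨K, hK, hμK⟩ := isTightMeasureSet_iff_exists_isCompact_measure_compl_le.1 ht
    (ENNReal.ofReal δ) (ENNReal.ofReal_pos.2 hδ)
  have hμK' : ∀ n, (μ n : Measure E) Kᶜ ≤ ENNReal.ofReal δ := fun n => hμK _ (mem_range_self n)
  have hpre : Φ ⁻¹' (Φ '' K)ᶜ = Kᶜ := by rw [preimage_compl, preimage_image_eq K hinj]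
  have hopen : IsOpen (Φ '' K)ᶜ := (hK.image hΦ).isClosed.isOpen_compl
  have hmap : ∀ ρ : ProbabilityMeasure E,
      (ρ.map hΦ.measurable.aemeasurable : Measure C) (Φ '' K)ᶜ = (ρ : Measure E) Kᶜ := fun ρ => by
    rw [ProbabilityMeasure.toMeasure_map, Measure.map_apply hΦ.measurable hopen.measurableSet, hpre]
  -- The limit is not assumed tight: its bound comes from the portmanteau inequality for the open
  -- set `(Φ '' K)ᶜ`.
  have hνK : (ν : Measure E) Kᶜ ≤ ENNReal.ofReal δ := by
    rw [← hmap ν]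
    refine (ProbabilityMeasure.le_liminf_measure_open_of_tendsto h hopen).trans ?_
    refine liminf_le_of_frequently_le' (Frequently.of_forall fun n => ?_)
    exact (hmap (μ n)).trans_le (hμK' n)
  have := isCompact_iff_compactSpace.1 hK
  obtain ⟨g, hg, hgf⟩ := BoundedContinuousFunction.exists_extension_norm_eq_of_isClosedEmbedding
    (f.domRestrict K) ((hΦ.comp continuous_subtype_val).isClosedEmbedding
      (hinj.comp Subtype.val_injective))
  have hgn : ‖g.compContinuous ⟨Φ, hΦ⟩‖ ≤ ‖f‖ := by
    refine (BoundedContinuousFunction.norm_compContinuous_le _ _).trans (hg.trans_le ?_)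
    exact BoundedContinuousFunction.norm_compContinuous_le _ _
  have hEq : EqOn f (g.compContinuous ⟨Φ, hΦ⟩) K := fun x hx => (congrFun hgf ⟨x, hx⟩).symm
  have hclose : ∀ ρ : ProbabilityMeasure E, (ρ : Measure E) Kᶜ ≤ ENNReal.ofReal δ →
      dist (∫ x, f x ∂(ρ : Measure E)) (∫ x, g (Φ x) ∂(ρ : Measure E)) ≤ ε / 4 := by
    intro ρ hρ
    refine (dist_integral_le_of_eqOn (ρ : Measure E) hEq).trans
      (le_trans ?_ hfδ)
    have h1 : (ρ : Measure E).real Kᶜ ≤ δ := ENNReal.toReal_le_of_le_ofReal hδ.le hρ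
    gcongr
  obtain ⟨N, hN⟩ := Metric.tendsto_atTop.1
    (ProbabilityMeasure.tendsto_iff_forall_integral_tendsto.1 h g) (ε / 4) (by positivity)
  refine ⟨N, fun n hn => ?_⟩
  have hint : ∀ ρ : ProbabilityMeasure E,
      ∫ c, g c ∂(ρ.map hΦ.measurable.aemeasurable : Measure C) = ∫ x, g (Φ x) ∂(ρ : Measure E) :=
    fun ρ => by
      rw [ProbabilityMeasure.toMeasure_map, integral_map hΦ.measurable.aemeasurable
        g.continuous.aestronglyMeasurable]
  have h1 := hclose (μ n) (hμK' n)
  have h2 := hclose ν hνK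
  have h3 := hN n hn
  rw [hint, hint] at h3
  rw [dist_comm] at h2
  linarith [dist_triangle4 (∫ x, f x ∂(μ n : Measure E)) (∫ x, g (Φ x) ∂(μ n : Measure E))
    (∫ x, g (Φ x) ∂(ν : Measure E)) (∫ x, f x ∂(ν : Measure E))]

/-- On a compact space, weak convergence can be tested on products of functions from a family
that separates points. -/
theorem MeasureTheory.ProbabilityMeasure.tendsto_of_forall_list_prod {C : Type*} [TopologicalSpace C]
    [CompactSpace C] [MeasurableSpace C] [OpensMeasurableSpace C] {μ : ℕ → ProbabilityMeasure C}
    {ν : ProbabilityMeasure C} {S : Set C(C, ℝ)}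
    (hS : ∀ x y, x ≠ y → ∃ f ∈ S, f x ≠ f y)
    (h : ∀ l : List C(C, ℝ), (∀ f ∈ l, f ∈ S) →
      Tendsto (fun n => ∫ c, l.prod c ∂(μ n : Measure C)) atTop
        (𝓝 (∫ c, l.prod c ∂(ν : Measure C)))) :
    Tendsto μ atTop (𝓝 ν) := by
  rw [ProbabilityMeasure.tendsto_iff_forall_integral_tendsto]
  have hint : ∀ (ρ : ProbabilityMeasure C) (f : C(C, ℝ)), Integrable f (ρ : Measure C) :=
    fun ρ f => (BoundedContinuousFunction.mkOfCompact f).integrable (ρ : Measure C)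
  let T : Set C(C, ℝ) := {f | Tendsto (fun n => ∫ c, f c ∂(μ n : Measure C)) atTop
        (𝓝 (∫ c, f c ∂(ν : Measure C)))}
  -- The algebra generated by `S` is the linear span of finite products from `S`; the empty list
  -- accounts for the constants.
  have hspan : ∀ f ∈ Algebra.adjoin ℝ S, f ∈ T := by
    intro f hf
    rw [← Subalgebra.mem_toSubmodule, Algebra.adjoin_eq_span] at hf
    induction hf using Submodule.span_induction with
    | mem x hx =>
      obtain ⟨l, hl, rfl⟩ := Submonoid.exists_list_of_mem_closure hx
      exact h l hl
    | zero => simp [T]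
    | add x y _ _ hx hy =>
      have := Tendsto.add hx hy
      simpa only [T, mem_ofPred_eq, ContinuousMap.add_apply, integral_add (hint _ x) (hint _ y)]
        using this
    | smul a x _ hx =>
      have := Tendsto.const_mul a hx
      simpa only [T, mem_ofPred_eq, ContinuousMap.smul_apply, smul_eq_mul, integral_const_mul]
        using this
  have hdist : ∀ (ρ : ProbabilityMeasure C) (f g : C(C, ℝ)),
      dist (∫ c, f c ∂(ρ : Measure C)) (∫ c, g c ∂(ρ : Measure C)) ≤ dist f g := by
    intro ρ f g
    rw [dist_eq_norm, ← integral_sub (hint ρ f) (hint ρ g)]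
    refine (norm_integral_le_of_norm_le_const (C := dist f g)
      (Eventually.of_forall fun c => ?_)).trans (by simp)
    rw [← dist_eq_norm]
    exact ContinuousMap.dist_apply_le_dist c
  have hclosed : IsClosed T := by
    refine isClosed_of_closure_subset fun f hf => ?_
    rw [Metric.mem_closure_iff] at hf
    refine Metric.tendsto_atTop.2 fun ε hε => ?_
    obtain ⟨g, hg, hfg⟩ := hf (ε / 3) (by positivity)
    obtain ⟨N, hN⟩ := Metric.tendsto_atTop.1 hg (ε / 3) (by positivity)
    refine ⟨N, fun n hn => ?_⟩
    have h1 := hdist (μ n) f g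
    have h2 := hdist ν g f
    rw [dist_comm g f] at h2
    linarith [hN n hn, dist_triangle4 (∫ c, f c ∂(μ n : Measure C)) (∫ c, g c ∂(μ n : Measure C))
      (∫ c, g c ∂(ν : Measure C)) (∫ c, f c ∂(ν : Measure C))]
  have hsep : (Algebra.adjoin ℝ S).SeparatesPoints := by
    intro x y hxy
    obtain ⟨f, hf, hne⟩ := hS x y hxy
    exact ⟨f, ⟨f, Algebra.subset_adjoin hf, rfl⟩, hne⟩
  have htop := ContinuousMap.subalgebra_topologicalClosure_eq_top_of_separatesPoints _ hsep
  intro f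
  have hmem : f.toContinuousMap ∈ (Algebra.adjoin ℝ S).topologicalClosure := htop ▸ trivial
  exact closure_minimal hspan hclosed hmem

end WeakConvergence

namespace SkorokhodD

/-! ### Convergence in the `M₁` distance -/

theorem exists_paramRep_of_distM1_lt {x y : SkorokhodD ℝ} {δ : ℝ≥0∞} (h : distM1 x y < δ) :
    ∃ (r₁ : C(I, I)) (u₁ : C(I, ℝ)) (r₂ : C(I, I)) (u₂ : C(I, ℝ)),
      x.IsParamRep r₁ u₁ ∧ y.IsParamRep r₂ u₂ ∧
        ∀ s, edist (r₁ s) (r₂ s) < δ ∧ edist (u₁ s) (u₂ s) < δ := by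
  simp only [distM1, iInf_lt_iff] at h
  obtain ⟨r₁, u₁, h₁, r₂, u₂, h₂, hlt⟩ := h
  have hr : ∀ s, edist (r₁ s) (r₂ s) ≤ edist r₁ r₂ := fun s => by
    rw [edist_dist, edist_dist]
    exact ENNReal.ofReal_le_ofReal (ContinuousMap.dist_apply_le_dist s)
  have hu : ∀ s, edist (u₁ s) (u₂ s) ≤ edist u₁ u₂ := fun s => by
    rw [edist_dist, edist_dist]
    exact ENNReal.ofReal_le_ofReal (ContinuousMap.dist_apply_le_dist s)
  exact ⟨r₁, u₁, r₂, u₂, h₁, h₂, fun s =>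
    ⟨(hr s).trans_lt ((le_max_left _ _).trans_lt hlt),
      (hu s).trans_lt ((le_max_right _ _).trans_lt hlt)⟩⟩

theorem IsParamRep.mem_graph {x : SkorokhodD ℝ} {r : C(I, I)} {u : C(I, ℝ)}
    (h : x.IsParamRep r u) (s : I) : (r s, u s) ∈ x.completedGraph :=
  h.range_eq ▸ mem_range_self s

theorem IsParamRep.exists_eq {x : SkorokhodD ℝ} {r : C(I, I)} {u : C(I, ℝ)}
    (h : x.IsParamRep r u) (t : I) : ∃ s, r s = t ∧ u s = x t := by
  have := x.mem_completedGraph t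
  rw [← h.range_eq] at this
  obtain ⟨s, hs⟩ := this
  exact ⟨s, congrArg Prod.fst hs, congrArg Prod.snd hs⟩

/-- The point `(1, x 1)` is the greatest in the completed graph, so a monotone parametrization onto
the graph must end there. -/
theorem IsParamRep.apply_one {x : SkorokhodD ℝ} {r : C(I, I)} {u : C(I, ℝ)}
    (h : x.IsParamRep r u) : u 1 = x 1 := by
  obtain ⟨s, hr, hu⟩ := h.exists_eq 1
  have hm := h.mem_graph 1
  have hg := h.mono s 1 unitInterval.le_one'
  simp only [GraphLE, hr, hu] at hg
  rcases hg with hg | ⟨h1, hle⟩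
  · exact absurd hg (not_lt.2 unitInterval.le_one')
  · rw [← h1] at hm hle
    simp only [completedGraph, mem_ofPred_eq, mem_uIcc] at hm
    rcases hm with ⟨ha, hb⟩ | ⟨ha, hb⟩
    · rw [abs_of_nonpos (by linarith), abs_of_nonpos (by linarith)] at hle
      linarith
    · rw [abs_of_nonneg (by linarith), abs_of_nonneg (by linarith)] at hle
      linarith

theorem tendsto_apply_one {x : SkorokhodD ℝ} {y : ℕ → SkorokhodD ℝ}
    (h : Tendsto (fun k => distM1 x (y k)) atTop (𝓝 0)) :
    Tendsto (fun k => y k 1) atTop (𝓝 (x 1)) := by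
  rw [EMetric.tendsto_nhds]
  intro ε hε
  filter_upwards [h.eventually_lt_const hε] with k hk
  obtain ⟨r₁, u₁, r₂, u₂, h₁, h₂, hlt⟩ := exists_paramRep_of_distM1_lt hk
  have := (hlt 1).2
  rwa [h₁.apply_one, h₂.apply_one, edist_comm] at this

/-- The point `(t, y k t)` is matched with a nearby point of the completed graph of `x`, whose time
is close to `t`; by continuity at `t` the graph of `x` there, vertical segments included, stays
close to `x t`. -/
theorem tendsto_apply_of_continuousAt {x : SkorokhodD ℝ} {y : ℕ → SkorokhodD ℝ}
    (h : Tendsto (fun k => distM1 x (y k)) atTop (𝓝 0)) {t : I} (ht : ContinuousAt x t) :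
    Tendsto (fun k => y k t) atTop (𝓝 (x t)) := by
  rw [Metric.tendsto_nhds]
  intro ε hε
  obtain ⟨η, hη, hball⟩ := Metric.eventually_nhds_iff_ball.1
    (ht.eventually (Metric.closedBall_mem_nhds (x t) (half_pos hε)))
  have hδ : (0 : ℝ≥0∞) < ENNReal.ofReal (min η (ε / 2)) :=
    ENNReal.ofReal_pos.2 (lt_min hη (half_pos hε))
  filter_upwards [h.eventually_lt_const hδ] with k hk
  obtain ⟨r₁, u₁, r₂, u₂, h₁, h₂, hlt⟩ := exists_paramRep_of_distM1_lt hk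
  obtain ⟨s, hr, hu⟩ := h₂.exists_eq t
  obtain ⟨hrs, hus⟩ := hlt s
  rw [hr, edist_lt_ofReal] at hrs
  rw [hu, edist_lt_ofReal] at hus
  have hmem : u₁ s ∈ Metric.closedBall (x t) (ε / 2) := by
    refine mem_of_mem_completedGraph Metric.isClosed_closedBall ?_ ?_ (h₁.mem_graph s)
    · rw [Real.closedBall_eq_Icc]; exact ordConnected_Icc
    · filter_upwards [Metric.isOpen_ball.mem_nhds
        (Metric.mem_ball.2 (hrs.trans_le (min_le_left _ _)))] with q hq
      exact hball q hq
  rw [Metric.mem_closedBall] at hmem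
  have := dist_triangle_left (y k t) (x t) (u₁ s)
  linarith [hus.trans_le (min_le_right _ _)]

/-- Only the description of open sets by balls is used: if no ball of radius `1 / (k + 1)` works,
bad points form a sequence at distance tending to 0. No metric axiom for `distM1` is needed. -/
theorem continuous_of_forall_tendsto_distM1 {F : SkorokhodD ℝ → ℝ}
    (h : ∀ (x : SkorokhodD ℝ) (y : ℕ → SkorokhodD ℝ),
      Tendsto (fun k => distM1 x (y k)) atTop (𝓝 0) →
        Tendsto (fun k => F (y k)) atTop (𝓝 (F x))) : Continuous F := by
  refine continuous_def.2 fun V hV => ?_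
  change ∀ x ∈ F ⁻¹' V, ∃ ε : ℝ≥0∞, 0 < ε ∧ ∀ y, distM1 x y < ε → y ∈ F ⁻¹' V
  intro x hx
  by_contra! hcon
  choose y hy hyV using fun k : ℕ => hcon ((k : ℝ≥0∞) + 1)⁻¹ (by simp)
  have h0 : Tendsto (fun k : ℕ => ((k : ℝ≥0∞) + 1)⁻¹) atTop (𝓝 0) := by
    have := (ENNReal.tendsto_inv_nat_nhds_zero).comp (tendsto_add_atTop_nat 1)
    simpa [Function.comp_def] using this
  have := h x y (tendsto_of_tendsto_of_tendsto_of_le_of_le tendsto_const_nhds h0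
    (fun _ => zero_le) fun k => (hy k).le)
  obtain ⟨k, hk⟩ := (this.eventually (hV.mem_nhds hx)).exists
  exact hyV k hk

/-! ### Window means -/

/-- The point `t + s / (n + 1)`, cut off at `1`. -/
noncomputable def shiftRight (t : I) (n : ℕ) (s : I) : I :=
  projIcc 0 1 zero_le_one ((t : ℝ) + s / ((n : ℝ) + 1))

theorem continuous_shiftRight (t : I) (n : ℕ) : Continuous (shiftRight t n) :=
  continuous_projIcc.comp (by fun_prop)

theorem tendsto_shiftRight (t s : I) : Tendsto (fun n => shiftRight t n s) atTop (𝓝[≥] t) := by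
  refine tendsto_nhdsWithin_iff.2 ⟨?_, Eventually.of_forall fun n => ?_⟩
  · have h : Tendsto (fun n : ℕ => (t : ℝ) + s / ((n : ℝ) + 1)) atTop (𝓝 t) := by
      have := (tendsto_one_div_add_atTop_nhds_zero_nat (𝕜 := ℝ)).const_mul (s : ℝ)
      simpa [div_eq_mul_inv] using tendsto_const_nhds.add this
    have := (continuous_projIcc (h := zero_le_one (α := ℝ))).continuousAt.tendsto.comp h
    simpa [shiftRight, Function.comp_def] using this
  · have h0 : (0 : ℝ) ≤ s / ((n : ℝ) + 1) := div_nonneg s.2.1 (by positivity)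
    have := monotone_projIcc (zero_le_one (α := ℝ)) (le_add_of_nonneg_right (a := (t : ℝ)) h0)
    rwa [projIcc_val] at this

theorem injOn_shiftRight (t : I) (n : ℕ) : InjOn (shiftRight t n) {s | shiftRight t n s ≠ 1} := by
  have key : ∀ s : I, shiftRight t n s ≠ 1 →
      (shiftRight t n s : ℝ) = (t : ℝ) + s / ((n : ℝ) + 1) := by
    intro s hs
    have h0 : (0 : ℝ) ≤ (t : ℝ) + s / ((n : ℝ) + 1) :=
      add_nonneg t.2.1 (div_nonneg s.2.1 (by positivity))
    have h1 : (t : ℝ) + s / ((n : ℝ) + 1) ≤ 1 := by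
      by_contra hlt
      exact hs (projIcc_of_right_le _ (not_le.1 hlt).le)
    rw [shiftRight, projIcc_of_mem _ ⟨h0, h1⟩]
  intro s hs s' hs' h
  have h1 := key s hs
  rw [h, key s' hs', add_right_inj, div_left_inj' (by positivity)] at h1
  exact Subtype.ext h1.symm

/-- Before the cut-off the map is affine and injective, so it pulls countable sets back to null
sets. The cut-off can send a set of positive measure to 1, hence the exception; at time 1
convergence holds anyway. -/
theorem ae_shiftRight {S : Set I} (hS : S.Countable) (t : I) (n : ℕ) :
    ∀ᵐ s : I, shiftRight t n s = 1 ∨ shiftRight t n s ∉ S := by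
  have hc : {s | shiftRight t n s ≠ 1 ∧ shiftRight t n s ∈ S}.Countable :=
    MapsTo.countable_of_injOn (f := shiftRight t n) (t := S) (fun s hs => hs.2)
      ((injOn_shiftRight t n).mono fun s hs => hs.1) hS
  filter_upwards [hc.ae_notMem volume] with s hs
  by_contra hcon
  push Not at hcon
  exact hs hcon

theorem norm_arctan_le (a : ℝ) : ‖Real.arctan a‖ ≤ 2 := by
  rw [Real.norm_eq_abs, abs_le]
  constructor <;> linarith [Real.neg_pi_div_two_lt_arctan a, Real.arctan_lt_pi_div_two a,
    Real.pi_le_four]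

/-- The mean of `arctan ∘ x` over the window `[t, t + 1 / (n + 1)]`, where `x` is extended by `x 1`
to the right of `1`. -/
noncomputable def windowMean (t : I) (n : ℕ) (x : SkorokhodD ℝ) : ℝ :=
  ∫ s : I, Real.arctan (x (shiftRight t n s))

theorem measurable_arctan_shiftRight (x : SkorokhodD ℝ) (t : I) (n : ℕ) :
    Measurable fun s => Real.arctan (x (shiftRight t n s)) :=
  Real.measurable_arctan.comp (x.measurable_path.comp (continuous_shiftRight t n).measurable)

theorem norm_windowMean_le (t : I) (n : ℕ) (x : SkorokhodD ℝ) : ‖windowMean t n x‖ ≤ 2 :=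
  (norm_integral_le_of_norm_le_const (C := 2) (Eventually.of_forall fun _ =>
    norm_arctan_le _)).trans (by simp)

theorem continuous_windowMean (t : I) (n : ℕ) : Continuous (windowMean t n) := by
  refine continuous_of_forall_tendsto_distM1 fun x y h => ?_
  refine tendsto_integral_of_dominated_convergence (fun _ => 2)
    (fun k => (measurable_arctan_shiftRight (y k) t n).aestronglyMeasurable)
    (integrable_const _) (fun k => Eventually.of_forall fun s => norm_arctan_le _) ?_
  filter_upwards [ae_shiftRight x.countable_disc t n] with s hs
  refine (Real.continuous_arctan.tendsto _).comp ?_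
  rcases hs with hs | hs
  · rw [hs]
    exact tendsto_apply_one h
  · exact tendsto_apply_of_continuousAt h (not_not.1 hs)

theorem tendsto_windowMean (t : I) (x : SkorokhodD ℝ) :
    Tendsto (fun n => windowMean t n x) atTop (𝓝 (Real.arctan (x t))) := by
  have : Real.arctan (x t) = ∫ _ : I, Real.arctan (x t) := by simp
  rw [this]
  refine tendsto_integral_of_dominated_convergence (fun _ => 2)
    (fun n => (measurable_arctan_shiftRight x t n).aestronglyMeasurable)
    (integrable_const _) (fun k => Eventually.of_forall fun s => norm_arctan_le _)
    (Eventually.of_forall fun s => ?_)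
  exact (Real.continuous_arctan.tendsto _).comp
    ((x.right_continuous' t).tendsto.comp (tendsto_shiftRight t s))

/-- Evaluation, although discontinuous, is Borel: its `arctan` is a pointwise limit of continuous
window means, and `tan` undoes the `arctan`. -/
theorem measurable_apply (t : I) : Measurable fun x : SkorokhodD ℝ => x t := by
  have h : Measurable fun x : SkorokhodD ℝ => Real.arctan (x t) :=
    measurable_of_tendsto_metrizable (fun n => (continuous_windowMean t n).measurable)
      (tendsto_pi_nhds.2 fun x => tendsto_windowMean t x)
  have h2 : Measurable Real.tan := by
    have : Real.tan = fun a => Real.sin a / Real.cos a := funext Real.tan_eq_sin_div_cos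
    rw [this]
    exact Real.measurable_sin.div Real.measurable_cos
  simpa [Function.comp_def, Real.tan_arctan] using h2.comp h

/-- Shrinking windows determine the path on `D`, and right-continuity determines it elsewhere. Time
1 must belong to `D`, since nothing lies to its right. -/
theorem eq_of_windowMean_eq {D : Set I} (hD : Dense D) (h1 : 1 ∈ D) {x y : SkorokhodD ℝ}
    (h : ∀ t ∈ D, ∀ n, windowMean t n x = windowMean t n y) : x = y := by
  have hDeq : ∀ t ∈ D, x t = y t := by
    intro t ht
    have hy := tendsto_windowMean t y
    simp only [← h t ht] at hy
    exact Real.arctan_injective (tendsto_nhds_unique (tendsto_windowMean t x) hy)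
  ext t
  rcases eq_or_lt_of_le (unitInterval.le_one' : t ≤ 1) with rfl | ht
  · exact hDeq 1 h1
  · refine tendsto_nhds_unique_of_frequently_eq
      ((x.right_continuous' t).mono Ioi_subset_Ici_self)
      ((y.right_continuous' t).mono Ioi_subset_Ici_self)
      ((nhdsGT_basis_of_exists_gt ⟨1, ht⟩).frequently_iff.2 fun u hu => ?_)
    obtain ⟨d, hd, hdD⟩ := hD.inter_open_nonempty _ isOpen_Ioo (nonempty_Ioo.2 hu)
    exact ⟨d, hd, hDeq d hdD⟩

end SkorokhodD

namespace SkorokhodD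

/-! ### The plane -/

theorem continuous_fst_snd : Continuous fun z : SkorokhodD (ℝ × ℝ) => (z.fst, z.snd) :=
  continuous_induced_dom

theorem continuous_fst : Continuous (fst : SkorokhodD (ℝ × ℝ) → SkorokhodD ℝ) :=
  _root_.continuous_fst.comp continuous_fst_snd

theorem continuous_snd : Continuous (snd : SkorokhodD (ℝ × ℝ) → SkorokhodD ℝ) :=
  _root_.continuous_snd.comp continuous_fst_snd

/-- The path with prescribed components. -/
def pair (x y : SkorokhodD ℝ) : SkorokhodD (ℝ × ℝ) where
  toFun t := (x t, y t)
  right_continuous' t := (x.right_continuous' t).prodMk (y.right_continuous' t)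
  exists_left_limit' t := by
    obtain ⟨a, ha⟩ := x.exists_left_limit' t
    obtain ⟨b, hb⟩ := y.exists_left_limit' t
    exact ⟨(a, b), ha.prodMk_nhds hb⟩

theorem isCompact_fst_snd_preimage {K L : Set (SkorokhodD ℝ)} (hK : IsCompact K)
    (hL : IsCompact L) : IsCompact {z : SkorokhodD (ℝ × ℝ) | z.fst ∈ K ∧ z.snd ∈ L} :=
  ((⟨rfl⟩ : IsInducing fun z : SkorokhodD (ℝ × ℝ) => (z.fst, z.snd)).isCompact_preimage_iff
    fun p _ => ⟨pair p.1 p.2, rfl⟩).2 (hK.prod hL)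

theorem isTightMeasureSet_of_fst_snd {S : Set (Measure (SkorokhodD (ℝ × ℝ)))}
    (h₁ : IsTightMeasureSet ((fun μ => μ.map fst) '' S))
    (h₂ : IsTightMeasureSet ((fun μ => μ.map snd) '' S)) : IsTightMeasureSet S := by
  rw [isTightMeasureSet_iff_exists_isCompact_measure_compl_le] at *
  intro ε hε
  obtain ⟨K, hK, hKS⟩ := h₁ (ε / 2) (ENNReal.half_pos hε.ne')
  obtain ⟨L, hL, hLS⟩ := h₂ (ε / 2) (ENNReal.half_pos hε.ne')
  refine ⟨_, isCompact_fst_snd_preimage hK hL, fun μ hμ => ?_⟩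
  have hsub : {z : SkorokhodD (ℝ × ℝ) | z.fst ∈ K ∧ z.snd ∈ L}ᶜ ⊆ fst ⁻¹' Kᶜ ∪ snd ⁻¹' Lᶜ := by
    intro z hz
    by_contra hcon
    simp only [mem_union, mem_preimage, mem_compl_iff, not_or, not_not] at hcon
    exact hz hcon
  calc μ {z : SkorokhodD (ℝ × ℝ) | z.fst ∈ K ∧ z.snd ∈ L}ᶜ
      ≤ μ (fst ⁻¹' Kᶜ) + μ (snd ⁻¹' Lᶜ) := (measure_mono hsub).trans (measure_union_le _ _)
    -- `K` and `L` are not known to be measurable; the inequality used for the push-forward holds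
    -- for arbitrary sets.
    _ ≤ ε / 2 + ε / 2 := add_le_add
        ((Measure.le_map_apply continuous_fst.measurable.aemeasurable _).trans
          (hKS _ (mem_image_of_mem _ hμ)))
        ((Measure.le_map_apply continuous_snd.measurable.aemeasurable _).trans
          (hLS _ (mem_image_of_mem _ hμ)))
    _ = ε := ENNReal.add_halves ε

/-- The components of a planar path, indexed by `Bool`. -/
def component (b : Bool) (z : SkorokhodD (ℝ × ℝ)) : SkorokhodD ℝ := bif b then z.fst else z.snd

theorem continuous_component (b : Bool) : Continuous (component b) := by
  cases b
  · exact continuous_snd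
  · exact continuous_fst

/-- The window means of both components at the times in `D`. -/
noncomputable def windowMeans (D : Set I) (z : SkorokhodD (ℝ × ℝ)) (i : Bool × D × ℕ) :
    Icc (-2 : ℝ) 2 :=
  ⟨windowMean i.2.1 i.2.2 (component i.1 z), abs_le.1 (norm_windowMean_le _ _ _)⟩

theorem continuous_windowMeans (D : Set I) : Continuous (windowMeans D) :=
  continuous_pi fun i => Continuous.subtype_mk
    ((continuous_windowMean i.2.1 i.2.2).comp (continuous_component i.1)) _

theorem injective_windowMeans {D : Set I} (hD : Dense D) (h1 : 1 ∈ D) :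
    Function.Injective (windowMeans D) := by
  intro z w h
  have hc : ∀ b, component b z = component b w := fun b =>
    eq_of_windowMean_eq hD h1 fun t ht n => congrArg Subtype.val (congrFun h (b, ⟨t, ht⟩, n))
  ext1 t
  exact Prod.ext (congrArg (fun x : SkorokhodD ℝ => x t) (hc true))
    (congrArg (fun x : SkorokhodD ℝ => x t) (hc false))

/-! ### Convergence of mixed moments of window means -/

/-- For each `ω` almost every `s` avoids the countable discontinuity set; Fubini exchanges the two
quantifiers. Time 0 is added to that set because `continuityTimes` excludes it. -/
theorem ae_shiftRight_mem_continuityTimes {Ω : Type*} [MeasurableSpace Ω] (P : Measure Ω)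
    [IsProbabilityMeasure P] {Y : Ω → SkorokhodD ℝ} (hY : Measurable Y) (t : I) (n : ℕ) :
    ∀ᵐ s : I, shiftRight t n s ∈ continuityTimes P Y := by
  have hmeas : MeasurableSet {p : Ω × I |
      shiftRight t n p.2 = 1 ∨ shiftRight t n p.2 ∉ insert 0 (Y p.1).disc} := by
    have hs : Measurable fun p : Ω × I => shiftRight t n p.2 :=
      (continuous_shiftRight t n).measurable.comp measurable_snd
    have hd := measurableSet_mem_disc fun t => (measurable_apply t).comp hY
    exact (hs (measurableSet_singleton 1)).union
      ((hs (measurableSet_singleton 0)).union ((measurable_fst.prodMk hs) hd)).compl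
  have h : ∀ᵐ ω ∂P, ∀ᵐ s : I,
      shiftRight t n s = 1 ∨ shiftRight t n s ∉ insert 0 (Y ω).disc :=
    Eventually.of_forall fun ω => ae_shiftRight ((Y ω).countable_disc.insert 0) t n
  rw [Measure.ae_ae_comm hmeas] at h
  filter_upwards [h] with s hs
  by_cases h1 : shiftRight t n s = 1
  · exact Or.inr h1
  · simp only [h1, false_or, mem_insert_iff, not_or] at hs
    -- That the time is not 0 does not depend on `ω`, so a single `ω` suffices.
    obtain ⟨ω, hω⟩ := hs.exists
    refine Or.inl ⟨unitInterval.pos_iff_ne_zero.2 hω.1, ?_⟩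
    have := hs.mono fun ω h => h.2
    simpa [ae_iff] using this

theorem measurable_prod_arctan_shiftRight {Ω : Type*} [MeasurableSpace Ω]
    {X : Ω → SkorokhodD (ℝ × ℝ)} (hX : Measurable X) {k : ℕ} (b : Fin k → Bool) (t : Fin k → I)
    (n : Fin k → ℕ) : Measurable fun p : Ω × (Fin k → I) =>
      ∏ j, Real.arctan (component (b j) (X p.1) (shiftRight (t j) (n j) (p.2 j))) := by
  refine Finset.measurable_prod _ fun j _ => Real.measurable_arctan.comp ?_
  have h := measurable_uncurry (Y := fun ω => component (b j) (X ω)) fun t =>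
    (measurable_apply t).comp ((continuous_component (b j)).measurable.comp hX)
  exact h.comp (measurable_fst.prodMk ((continuous_shiftRight (t j) (n j)).measurable.comp
    ((measurable_pi_apply j).comp measurable_snd)))

theorem norm_prod_arctan_le {k : ℕ} (a : Fin k → ℝ) : ‖∏ j, Real.arctan (a j)‖ ≤ 2 ^ k := by
  rw [norm_prod]
  refine (Finset.prod_le_prod (fun _ _ => norm_nonneg _) fun j _ => norm_arctan_le (a j)).trans ?_
  simp

/-- A product of `k` integrals over `I` is one integral over `I ^ k`, and Fubini moves the
expectation inside, where the times are deterministic. -/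
theorem integral_prod_windowMean {Ω : Type*} [MeasurableSpace Ω] (P : Measure Ω)
    [IsProbabilityMeasure P] {X : Ω → SkorokhodD (ℝ × ℝ)} (hX : Measurable X) {k : ℕ}
    (b : Fin k → Bool) (t : Fin k → I) (n : Fin k → ℕ) :
    ∫ ω, ∏ j, windowMean (t j) (n j) (component (b j) (X ω)) ∂P =
      ∫ s : Fin k → I, ∫ ω,
        ∏ j, Real.arctan (component (b j) (X ω) (shiftRight (t j) (n j) (s j))) ∂P := by
  rw [← integral_integral_swap]
  · refine integral_congr_ae (Eventually.of_forall fun ω => ?_)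
    exact (integral_fintype_prod_eq_prod (μ := fun _ : Fin k => (volume : Measure I)) fun j s =>
      Real.arctan (component (b j) (X ω) (shiftRight (t j) (n j) s))).symm
  · exact Integrable.of_bound
      (measurable_prod_arctan_shiftRight hX b t n).aestronglyMeasurable (2 ^ k)
      (Eventually.of_forall fun _ => norm_prod_arctan_le _)

theorem tendsto_integral_prod_windowMean {Ω : ℕ → Type*} {Ω' : Type*}
    [∀ n, MeasurableSpace (Ω n)] [MeasurableSpace Ω']
    (P : (n : ℕ) → Measure (Ω n)) [∀ n, IsProbabilityMeasure (P n)]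
    (P' : Measure Ω') [IsProbabilityMeasure P']
    {X : (n : ℕ) → Ω n → SkorokhodD (ℝ × ℝ)} (hX : ∀ n, Measurable (X n))
    {Z : Ω' → SkorokhodD (ℝ × ℝ)} (hZ : Measurable Z)
    (h_fidi : ∀ (k : ℕ) (t : Fin k → I),
      (∀ i, t i ∈ continuityTimes P' (fun ω => (Z ω).fst) ∩
        continuityTimes P' (fun ω => (Z ω).snd)) →
      TendstoInDistribution
        (fun n ω => ((fun i => (X n ω).fst (t i), fun i => (X n ω).snd (t i)) :
          (Fin k → ℝ) × (Fin k → ℝ)))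
        atTop
        (fun ω => ((fun i => (Z ω).fst (t i), fun i => (Z ω).snd (t i)) :
          (Fin k → ℝ) × (Fin k → ℝ)))
        P P')
    {k : ℕ} (b : Fin k → Bool) (t : Fin k → I) (n : Fin k → ℕ) :
    Tendsto (fun m => ∫ ω, ∏ j, windowMean (t j) (n j) (component (b j) (X m ω)) ∂P m) atTop
      (𝓝 (∫ ω, ∏ j, windowMean (t j) (n j) (component (b j) (Z ω)) ∂P')) := by
  simp only [integral_prod_windowMean _ (hX _), integral_prod_windowMean _ hZ]
  refine tendsto_integral_of_dominated_convergence (fun _ => 2 ^ k) (fun m => ?_)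
    (integrable_const _) (fun m => Eventually.of_forall fun s => ?_) ?_
  · exact (measurable_prod_arctan_shiftRight (hX m) b t
      n).stronglyMeasurable.integral_prod_left'.aestronglyMeasurable
  · exact (norm_integral_le_of_norm_le_const (C := 2 ^ k) (Eventually.of_forall fun _ =>
      norm_prod_arctan_le _)).trans (by simp)
  · have hgood : ∀ᵐ s : Fin k → I, ∀ j, shiftRight (t j) (n j) (s j) ∈
        continuityTimes P' (fun ω => (Z ω).fst) ∩ continuityTimes P' (fun ω => (Z ω).snd) := by
      refine ae_all_iff.2 fun j => ?_
      have h := (ae_shiftRight_mem_continuityTimes P' (continuous_fst.measurable.comp hZ)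
        (t j) (n j)).and (ae_shiftRight_mem_continuityTimes P'
          (continuous_snd.measurable.comp hZ) (t j) (n j))
      -- A coordinate projection preserves the uniform measure, so a null set of bad times for one
      -- coordinate is null in the cube.
      exact (measurePreserving_eval (fun _ : Fin k => (volume : Measure I))
        j).quasiMeasurePreserving.ae h
    filter_upwards [hgood] with s hs
    have hconv := h_fidi k (fun j => shiftRight (t j) (n j) (s j)) hs
    -- Thanks to `arctan` the mixed product is a bounded continuous test function of the
    -- finite-dimensional vector.
    let H : BoundedContinuousFunction ((Fin k → ℝ) × (Fin k → ℝ)) ℝ :=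
      BoundedContinuousFunction.ofNormedAddCommGroup
        (fun p => ∏ j, Real.arctan (bif b j then p.1 j else p.2 j))
        (continuous_finsetProd Finset.univ fun j _ => Real.continuous_arctan.comp (by
          cases b j
          · exact (continuous_apply j).comp _root_.continuous_snd
          · exact (continuous_apply j).comp _root_.continuous_fst))
        (2 ^ k) (fun p => norm_prod_arctan_le _)
    have hH := ProbabilityMeasure.tendsto_iff_forall_integral_tendsto.1 hconv.tendsto H
    simp only [ProbabilityMeasure.coe_mk] at hH
    rw [integral_map hconv.aemeasurable_limit H.continuous.aestronglyMeasurable] at hH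
    have happ : ∀ (z : SkorokhodD (ℝ × ℝ)),
        H ((fun i => z.fst (shiftRight (t i) (n i) (s i))),
          fun i => z.snd (shiftRight (t i) (n i) (s i))) =
        ∏ j, Real.arctan (component (b j) z (shiftRight (t j) (n j) (s j))) := by
      intro z
      change ∏ j, Real.arctan (bif b j then z.fst (shiftRight (t j) (n j) (s j))
        else z.snd (shiftRight (t j) (n j) (s j))) = _
      refine Finset.prod_congr rfl fun j _ => ?_
      cases b j <;> rfl
    simp only [happ] at hH
    refine hH.congr fun m => ?_
    rw [integral_map (hconv.forall_aemeasurable m) H.continuous.aestronglyMeasurable]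
    simp only [happ]

end SkorokhodD

/-! ### Weak convergence from tightness and mixed moments -/

open SkorokhodD in
theorem theorem3p2 {Ω : ℕ → Type*} {Ω' : Type*}
    [mΩ : ∀ n, MeasurableSpace (Ω n)] [mΩ' : MeasurableSpace Ω']
    (P : (n : ℕ) → Measure (Ω n)) [∀ n, IsProbabilityMeasure (P n)]
    (P' : Measure Ω') [IsProbabilityMeasure P']
    (X : (n : ℕ) → Ω n → SkorokhodD (ℝ × ℝ)) (hX : ∀ n, Measurable (X n))
    (Z : Ω' → SkorokhodD (ℝ × ℝ)) (hZ : Measurable Z)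
    (hY_tight : IsTightMeasureSet (range fun n => (P n).map fun ω => (X n ω).fst))
    (hQ_tight : IsTightMeasureSet (range fun n => (P n).map fun ω => (X n ω).snd))
    (h_fidi : ∀ (k : ℕ) (t : Fin k → I),
      (∀ i, t i ∈ SkorokhodD.continuityTimes P' (fun ω => (Z ω).fst) ∩
        SkorokhodD.continuityTimes P' (fun ω => (Z ω).snd)) →
      TendstoInDistribution
        (fun n ω => ((fun i => (X n ω).fst (t i), fun i => (X n ω).snd (t i)) :
          (Fin k → ℝ) × (Fin k → ℝ)))
        atTop
        (fun ω => ((fun i => (Z ω).fst (t i), fun i => (Z ω).snd (t i)) :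
          (Fin k → ℝ) × (Fin k → ℝ)))
        P P') :
    TendstoInDistribution X atTop Z P P' := by
  refine ⟨fun n => (hX n).aemeasurable, hZ.aemeasurable, ?_⟩
  obtain ⟨D₀, hD₀c, hD₀⟩ := TopologicalSpace.exists_countable_dense I
  -- Countability of the set of times makes the cube a countable product, hence metrizable, with
  -- Borel σ-algebra equal to the product one.
  have hc : (insert 1 D₀).Countable := hD₀c.insert 1
  have : Countable ↥(insert 1 D₀) := hc.to_subtype
  have hΦ := continuous_windowMeans (insert 1 D₀)
  refine ProbabilityMeasure.tendsto_of_isTightMeasureSet_of_injective hΦ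
    (injective_windowMeans (hD₀.mono (subset_insert _ _)) (mem_insert _ _)) ?_ ?_
  · refine isTightMeasureSet_of_fst_snd ?_ ?_
    · rw [← range_comp]
      convert hY_tight using 3 with n
      exact Measure.map_map continuous_fst.measurable (hX n)
    · rw [← range_comp]
      convert hQ_tight using 3 with n
      exact Measure.map_map continuous_snd.measurable (hX n)
  · let ev : (Bool × ↥(insert 1 D₀) × ℕ) → C(Bool × ↥(insert 1 D₀) × ℕ → Icc (-2 : ℝ) 2, ℝ) :=
      fun i => ⟨fun c => c i, continuous_subtype_val.comp (continuous_apply i)⟩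
    refine ProbabilityMeasure.tendsto_of_forall_list_prod (S := range ev) ?_ ?_
    · intro x y hxy
      obtain ⟨i, hi⟩ := Function.ne_iff.1 hxy
      exact ⟨ev i, mem_range_self i, fun h => hi (Subtype.ext h)⟩
    · intro l hl
      -- A list of coordinate functions becomes a finite family of indices, repetitions allowed, so
      -- its product is a mixed moment of window means.
      choose idx hidx using fun j : Fin l.length => hl (l.get j) (l.get_mem j)
      have hprod : ∀ z, l.prod (windowMeans (insert 1 D₀) z) =
          ∏ j, windowMean (idx j).2.1 (idx j).2.2 (component (idx j).1 z) := by
        intro z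
        rw [← Fin.prod_univ_getElem, ContinuousMap.prod_apply]
        exact Finset.prod_congr rfl fun j _ => (DFunLike.congr_fun (hidx j) _).symm
      have hmap : ∀ ρ : Measure (SkorokhodD (ℝ × ℝ)),
          ∫ c, l.prod c ∂(ρ.map (windowMeans (insert 1 D₀))) =
            ∫ z, ∏ j, windowMean (idx j).2.1 (idx j).2.2 (component (idx j).1 z) ∂ρ := by
        intro ρ
        rw [integral_map hΦ.measurable.aemeasurable l.prod.continuous.aestronglyMeasurable]
        simp only [hprod]
      have hmeas : Measurable fun z =>
          ∏ j, windowMean (idx j).2.1 (idx j).2.2 (component (idx j).1 z) :=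
        Finset.measurable_prod _ fun j _ => ((continuous_windowMean _ _).comp
          (continuous_component _)).measurable
      have hlim : Tendsto
          (fun n => ∫ c, l.prod c ∂(((P n).map (X n)).map (windowMeans (insert 1 D₀)))) atTop
          (𝓝 (∫ c, l.prod c ∂((P'.map Z).map (windowMeans (insert 1 D₀))))) := by
        simp only [hmap, integral_map (hX _).aemeasurable hmeas.aestronglyMeasurable,
          integral_map hZ.aemeasurable hmeas.aestronglyMeasurable]
        exact tendsto_integral_prod_windowMean P P' hX hZ h_fidi _ _ _
      exact hlim
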